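/- Let $F$ be a field with $\operatorname{char}(F)\neq 2$ and let $A$ be a finite-dimensional associative (not necessarily unital) $F$-algebra that is semisimple, i.e. whose radical (its unique maximal nilpotent two-sided ideal) is zero. An *inner derivation* of $A$ is a map of the form $x\mapsto [a,x]=ax-xa$ with $a\in A$. Let $D:A\to A$ be an $F$-linear map that is a *local inner derivation*: for every $x\in A$ there is an inner derivation $D_x:A\to A$ with $D(x)=D_x(x)$. Then $D$ is an inner derivation of $A$. -/

import Mathlib

/-! Associative algebras over a field `F` are not assumed to have a unit: an `F`-algebra `A` is a
`NonUnitalRing` with an `F`-module structure for which multiplication is `F`-bilinear. -/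

namespace FDAlg

section

variable (F : Type*) {A : Type*} [Field F] [NonUnitalRing A] [Module F A]
  [IsScalarTower F A A] [SMulCommClass F A A]

/-- A linear subspace `I` of `A` is a (two-sided) ideal of the algebra `A`. -/
def IsAlgIdeal (I : Submodule F A) : Prop :=
  ∀ a : A, ∀ x ∈ I, a * x ∈ I ∧ x * a ∈ I

/-- The product `I J`: the linear span of all `x * y` with `x ∈ I` and `y ∈ J`. -/
def idealMul (I J : Submodule F A) : Submodule F A :=
  Submodule.span F {z | ∃ x ∈ I, ∃ y ∈ J, z = x * y}

/-- `idealPowSucc F I n` is the power `I ^ (n + 1)`. (The exponent is shifted because `I ^ 0` has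
no meaning in an algebra without unit.) -/
def idealPowSucc (I : Submodule F A) : ℕ → Submodule F A
  | 0 => I
  | n + 1 => idealMul F (idealPowSucc I n) I

/-- Some power of `I` with positive exponent is zero. -/
def IsNilpotentIdeal (I : Submodule F A) : Prop :=
  ∃ n : ℕ, idealPowSucc F I n = ⊥

variable (A)

/-- The radical of `A`: the sum of all nilpotent ideals. For a finite-dimensional algebra this is
the unique maximal nilpotent ideal. -/
def radical : Submodule F A :=
  sSup {I : Submodule F A | IsAlgIdeal F I ∧ IsNilpotentIdeal F I}

/-- A (finite-dimensional) algebra is semisimple if its radical is zero. -/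
def IsSemisimpleAlg : Prop :=
  radical F A = ⊥

variable {F A}

/-- A linear map `D : A → A` is an inner derivation if `D x = [a, x] = a * x - x * a` for some
fixed `a`. -/
def IsInnerDerivation (D : A →ₗ[F] A) : Prop :=
  ∃ a : A, ∀ x : A, D x = a * x - x * a

/-- A linear map `D : A → A` is a local inner derivation if at every `x` it agrees with some inner
derivation, which may depend on `x`. -/
def IsLocalInnerDerivation (D : A →ₗ[F] A) : Prop :=
  ∀ x : A, ∃ Dx : A →ₗ[F] A, IsInnerDerivation Dx ∧ D x = Dx x

end

end FDAlg

/-! Adjoining a unit and extending `D` by zero reduces to a semisimple ring, hence to its simple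
factors, each central simple over its center. There some nonzero functional `g` kills commutators,
its trace form is nondegenerate, and `D x = [a, x]` gives `g (D x * x) = g (D x * (x * x)) = 0`.
Polarizing makes `D` a Jordan derivation (`jordanDerivation_of_local`). Herstein's argument makes it
a derivation (`mul_of_jordanDerivation`), which is inner because every linear map is a sum of maps
`x ↦ a x b` (`mulLeftRight_surjective`). -/

namespace FDAlg

open TensorProduct

/-! ### Multiplication algebra and trace form -/

section CentralSimple

variable {K A : Type*} [Field K] [Ring A] [Algebra K A]

/-- Membership of the center gives a scalar. -/
theorem exists_algebraMap_eq_of_commute [Algebra.IsCentral K A] {z : A}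
    (hz : ∀ x, x * z = z * x) : ∃ k : K, algebraMap K A k = z := by
  have : z ∈ Subalgebra.center K A := Subalgebra.mem_center_iff.2 hz
  exact Algebra.mem_bot.1 (Algebra.IsCentral.out this)

/-- The multiplication algebra of a central simple algebra consists of all linear maps. -/
theorem mulLeftRight_surjective [Algebra.IsCentral K A] [IsSimpleRing A] [FiniteDimensional K A] :
    Function.Surjective (AlgHom.mulLeftRight K A) := by
  classical
  intro f
  let _ : Module (A ⊗[K] Aᵐᵒᵖ) A := TensorProduct.Algebra.module
  have smul_def' (t : A ⊗[K] Aᵐᵒᵖ) (x : A) : t • x = AlgHom.mulLeftRight K A t x := rfl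
  have hsimple : IsSimpleModule (A ⊗[K] Aᵐᵒᵖ) A := by
    rw [isSimpleModule_iff]
    refine { exists_pair_ne := ⟨⊥, ⊤, bot_ne_top⟩, eq_bot_or_eq_top := fun N => ?_ }
    rw [or_iff_not_imp_left]
    intro hN
    obtain ⟨x, hx, hx0⟩ := (Submodule.ne_bot_iff N).1 hN
    have hl (a y : A) (hy : y ∈ N) : a * y ∈ N := by
      simpa [smul_def'] using N.smul_mem (a ⊗ₜ 1) hy
    have hr (a y : A) (hy : y ∈ N) : y * a ∈ N := by
      simpa [smul_def'] using N.smul_mem (1 ⊗ₜ MulOpposite.op a) hy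
    let I := TwoSidedIdeal.mk' (N : Set A) N.zero_mem (fun h₁ h₂ => N.add_mem h₁ h₂)
      (fun h => N.neg_mem h) (fun h => hl _ _ h) (fun h => hr _ _ h)
    have h1 : (1 : A) ∈ I :=
      IsSimpleRing.one_mem_of_ne_zero_mem I hx0 (by simpa [I, TwoSidedIdeal.mem_mk'] using hx)
    have h1 : (1 : A) ∈ N := by simpa [I, TwoSidedIdeal.mem_mk'] using h1
    exact eq_top_iff.2 fun y _ => by simpa using hl y 1 h1
  -- Endomorphisms of the simple module `A` are multiplications by central scalars, so every
  -- `K`-linear map commutes with them and density applies on a basis.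
  let f' : Module.End (Module.End (A ⊗[K] Aᵐᵒᵖ) A) A :=
    { toFun := f
      map_add' := f.map_add
      map_smul' := fun g x => by
        have hgl (a x : A) : g (a * x) = a * g x := by
          simpa [smul_def'] using g.map_smul (a ⊗ₜ 1) x
        have hgr (a x : A) : g (x * a) = g x * a := by
          simpa [smul_def'] using g.map_smul (1 ⊗ₜ MulOpposite.op a) x
        obtain ⟨k, hk⟩ := exists_algebraMap_eq_of_commute (K := K) (z := g 1)
          (fun x => by rw [← hgl, ← hgr, mul_one, one_mul])
        have hg (x : A) : g x = k • x := by
          rw [Algebra.smul_def, hk, ← hgr, one_mul]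
        simp [hg] }
  let b := Module.finBasis K A
  obtain ⟨r, hr⟩ := jacobson_density f' (Finset.univ.image b)
  exact ⟨r, b.ext fun i => (hr (b i) (by simp)).symm⟩

/-- In a central simple algebra, the maps `x ↦ ∑ aᵢ x bᵢ` with linearly independent `bᵢ` vanish
only if all `aᵢ` do. -/
theorem eq_zero_of_sum_mul_mul_eq_zero [Algebra.IsCentral K A] [IsSimpleRing A]
    [FiniteDimensional K A] {ι : Type*} [Fintype ι] {a b : ι → A} (hb : LinearIndependent K b)
    (h : ∀ x, ∑ i, a i * x * b i = 0) (j : ι) : a j = 0 := by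
  classical
  -- Substituting `x * p` and multiplying by `q` on the right turns `b i` into `p * b i * q`, hence
  -- into any linear image of `b i`.
  have key (t : A ⊗[K] Aᵐᵒᵖ) : ∀ x, ∑ i, a i * x * AlgHom.mulLeftRight K A t (b i) = 0 := by
    induction t with
    | zero => simp
    | tmul p q =>
      intro x
      have := congrArg (· * q.unop) (h (x * p))
      simpa [Finset.sum_mul, mul_assoc] using this
    | add s t hs ht =>
      intro x
      simp [mul_add, Finset.sum_add_distrib, hs, ht]
  obtain ⟨f, hf⟩ := LinearMap.exists_extend
    ((Module.Basis.span hb).constr K (fun i => if i = j then (1 : A) else 0))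
  have hf' (i : ι) : f (b i) = if i = j then 1 else 0 := by
    have := congrArg (fun g => g (Module.Basis.span hb i)) hf
    simpa [Module.Basis.span_apply, Finsupp.single_apply] using this
  obtain ⟨t, ht⟩ := mulLeftRight_surjective f
  have := key t 1
  simpa [ht, hf'] using this

/-- Scalar extensions of central simple algebras are simple. -/
theorem isSimpleRing_baseChange [Algebra.IsCentral K A] [IsSimpleRing A] [FiniteDimensional K A]
    (L : Type*) [Field L] [Algebra K L] : IsSimpleRing (L ⊗[K] A) := by
  classical
  have hnt : Nontrivial (L ⊗[K] A) := inferInstance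
  refine ⟨{ exists_pair_ne := ⟨⊥, ⊤, bot_ne_top⟩, eq_bot_or_eq_top := fun I => ?_ }⟩
  rw [or_iff_not_imp_left]
  intro hI
  obtain ⟨x, hx, hx0⟩ : ∃ x ∈ I, x ≠ 0 := by
    by_contra! hcon
    exact hI (le_bot_iff.1 fun x hx => by simpa [TwoSidedIdeal.mem_bot] using hcon x hx)
  have key (t : A ⊗[K] Aᵐᵒᵖ) :
      (AlgHom.mulLeftRight K A t).lTensor L x ∈ I := by
    induction t with
    | zero => simp
    | tmul p q =>
      have : (AlgHom.mulLeftRight K A (p ⊗ₜ q)).lTensor L x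
          = (1 ⊗ₜ p) * x * (1 ⊗ₜ q.unop) := by
        clear hx hx0
        induction x with
        | zero => simp
        | tmul l y => simp
        | add s t hs ht => rw [map_add, hs, ht, mul_add, add_mul]
      rw [this]
      exact I.mul_mem_right _ _ (I.mul_mem_left _ _ hx)
    | add s t hs ht => simpa [LinearMap.lTensor_add] using I.add_mem hs ht
  let b := Module.finBasis K A
  obtain ⟨c, hc⟩ := TensorProduct.eq_repr_basis_right (M := L) b x
  obtain ⟨j, hj⟩ : ∃ j, c j ≠ 0 := by
    by_contra! hcon
    have : c = 0 := Finsupp.ext hcon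
    exact hx0 (by rw [← hc, this, Finsupp.sum_zero_index])
  obtain ⟨t, ht⟩ := mulLeftRight_surjective (K := K) (b.constr K fun i => if i = j then (1 : A) else 0)
  have h1 := key t
  have h2 : (AlgHom.mulLeftRight K A t).lTensor L x = c j ⊗ₜ 1 := by
    rw [ht, ← hc, Finsupp.sum_fintype _ _ (by simp)]
    simp [apply_ite]
  rw [h2] at h1
  have h3 := I.mul_mem_left ((c j)⁻¹ ⊗ₜ 1) _ h1
  rw [Algebra.TensorProduct.tmul_mul_tmul, inv_mul_cancel₀ hj, one_mul,
    ← Algebra.TensorProduct.one_def] at h3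
  exact I.one_mem_iff.1 h3

/-- A central simple algebra has a nonzero linear functional that vanishes on commutators. -/
theorem exists_trace_ne_zero [Algebra.IsCentral K A] [IsSimpleRing A] [FiniteDimensional K A] :
    ∃ g : A →ₗ[K] K, g ≠ 0 ∧ ∀ x y, g (x * y) = g (y * x) := by
  let W : Submodule K A := Submodule.span K {z | ∃ x y : A, z = x * y - y * x}
  have hW : W < ⊤ := by
    rw [lt_top_iff_ne_top]
    intro htop
    let L := AlgebraicClosure K
    have := isSimpleRing_baseChange (K := K) (A := A) L
    obtain ⟨n, hn, ⟨e⟩⟩ := IsSimpleRing.exists_algEquiv_matrix_of_isAlgClosed L (L ⊗[K] A)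
    let T : L ⊗[K] A →ₗ[L] L := Matrix.traceLinearMap (Fin n) L L ∘ₗ e.toLinearMap
    have hT (x y) : T (x * y) = T (y * x) := by
      simpa [T] using Matrix.trace_mul_comm (e x) (e y)
    have hT1 (y : A) : T (1 ⊗ₜ y) = 0 := by
      have hy : y ∈ W := htop ▸ Submodule.mem_top
      induction hy using Submodule.span_induction with
      | mem z hz =>
        obtain ⟨u, v, rfl⟩ := hz
        have := hT (1 ⊗ₜ u) (1 ⊗ₜ v)
        simp only [Algebra.TensorProduct.tmul_mul_tmul, mul_one] at this
        rw [TensorProduct.tmul_sub, map_sub, this, sub_self]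
      | zero => simp
      | add u v _ _ hu hv => rw [TensorProduct.tmul_add, map_add, hu, hv, add_zero]
      | smul k u _ hu =>
        rw [TensorProduct.tmul_smul, ← algebraMap_smul L k, map_smul, hu, smul_zero]
    have hT0 (x : L ⊗[K] A) : T x = 0 := by
      induction x with
      | zero => simp
      | tmul l y =>
        have : l ⊗ₜ[K] y = l • ((1 : L) ⊗ₜ[K] y) := by simp [TensorProduct.smul_tmul']
        rw [this, map_smul, hT1, smul_zero]
      | add s t hs ht => rw [map_add, hs, ht, add_zero]
    -- A matrix unit has trace `1` in every characteristic, unlike the identity matrix.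
    have := hT0 (e.symm (Matrix.single 0 0 1))
    simp [T] at this
  obtain ⟨g, hg0, hg⟩ := Submodule.exists_le_ker_of_lt_top W hW
  refine ⟨g, hg0, fun x y => sub_eq_zero.1 ?_⟩
  rw [← map_sub]
  exact hg (Submodule.subset_span ⟨x, y, rfl⟩)

/-- The bilinear form of a nonzero trace on a central simple algebra is nondegenerate. -/
theorem eq_zero_of_trace_mul_eq_zero [Algebra.IsCentral K A] [IsSimpleRing A]
    [FiniteDimensional K A] {g : A →ₗ[K] K} (hg0 : g ≠ 0) (hg : ∀ x y, g (x * y) = g (y * x))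
    {x : A} (hx : ∀ y, g (x * y) = 0) : x = 0 := by
  by_contra hx0
  refine hg0 (LinearMap.ext fun z => ?_)
  have key (t : A ⊗[K] Aᵐᵒᵖ) : ∀ y, g (AlgHom.mulLeftRight K A t x * y) = 0 := by
    induction t with
    | zero => simp
    | tmul p q =>
      intro y
      rw [AlgHom.mulLeftRight_apply, mul_assoc, mul_assoc, hg, mul_assoc]
      exact hx _
    | add s t hs ht => intro y; simp [add_mul, hs, ht]
  obtain ⟨f, hf⟩ := Module.Projective.exists_dual_ne_zero K hx0
  obtain ⟨t, ht⟩ := mulLeftRight_surjective (K := K) ((f x)⁻¹ • f.smulRight (1 : A))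
  simpa [ht, hf] using key t z

end CentralSimple

/-! ### Herstein's identities for Jordan derivations -/

section JordanDerivation

variable {A : Type*} [Ring A] {D : A →+ A}

/-- The expansion of a Jordan derivation on triple products `x * y * x`. -/
theorem jordanDerivation_triple (h2 : IsUnit (2 : A))
    (hJ : ∀ x y, D (x * y + y * x) = D x * y + x * D y + (D y * x + y * D x)) (x y : A) :
    D (x * y * x) = D x * y * x + x * D y * x + x * y * D x := by
  have e : x * (x * y + y * x) + (x * y + y * x) * x - (x * x * y + y * (x * x))
      = x * y * x + x * y * x := by noncomm_ring
  have hxx : D (x * x) + D (x * x) = (D x * x + x * D x) + (D x * x + x * D x) := by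
    rw [← map_add, hJ]
  have hxx' : D (x * x) = D x * x + x * D x := by
    rw [← two_mul, ← two_mul] at hxx
    exact h2.mul_left_cancel hxx
  have h := congrArg D e
  rw [map_sub, hJ x (x * y + y * x), hJ (x * x) y, hJ x y, hxx', map_add, ← two_mul] at h
  refine h2.mul_left_cancel (h.symm.trans ?_)
  noncomm_ring

/-- The linearized expansion of a Jordan derivation on triple products. -/
theorem jordanDerivation_triple_add (h2 : IsUnit (2 : A))
    (hJ : ∀ x y, D (x * y + y * x) = D x * y + x * D y + (D y * x + y * D x)) (x y z : A) :
    D (x * y * z + z * y * x) = D x * y * z + x * D y * z + x * y * D z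
      + (D z * y * x + z * D y * x + z * y * D x) := by
  have e : x * y * z + z * y * x = (x + z) * y * (x + z) - x * y * x - z * y * z := by
    noncomm_ring
  rw [e, map_sub, map_sub, jordanDerivation_triple h2 hJ, jordanDerivation_triple h2 hJ,
    jordanDerivation_triple h2 hJ, map_add]
  noncomm_ring

/-- Herstein's identity for the defect of a Jordan derivation. -/
theorem jordanDerivation_defect_mul (h2 : IsUnit (2 : A))
    (hJ : ∀ x y, D (x * y + y * x) = D x * y + x * D y + (D y * x + y * D x)) (a b x : A) :
    (D (a * b) - D a * b - a * D b) * x * (a * b - b * a)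
      + (a * b - b * a) * x * (D (a * b) - D a * b - a * D b) = 0 := by
  have hba : D (b * a) = D a * b + a * D b + (D b * a + b * D a) - D (a * b) := by
    rw [eq_sub_iff_add_eq, ← map_add, add_comm, hJ]
  -- `D` of this element is computed in two ways: by the linearized triple rule and by nested triple
  -- rules.
  have e : (a * b) * x * (b * a) + (b * a) * x * (a * b)
      = a * (b * x * b) * a + b * (a * x * a) * b := by noncomm_ring
  have h := congrArg D e
  rw [jordanDerivation_triple_add h2 hJ, map_add, jordanDerivation_triple h2 hJ a (b * x * b),
    jordanDerivation_triple h2 hJ b (a * x * a), jordanDerivation_triple h2 hJ a,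
    jordanDerivation_triple h2 hJ b, hba] at h
  rw [← sub_eq_zero] at h
  rw [← neg_eq_zero, ← h]
  noncomm_ring

end JordanDerivation

/-! ### From local inner to inner on central simple algebras -/

section CentralSimple

variable {K A : Type*} [Field K] [Ring A] [Algebra K A] [Algebra.IsCentral K A] [IsSimpleRing A]
  [FiniteDimensional K A] {D : A →+ A}

/-- If `d x c + c x d = 0` for all `x` in a central simple algebra, then `d = 0` or `c = 0`. -/
theorem eq_zero_of_mul_mul_add_eq_zero (h2 : (2 : K) ≠ 0) {c d : A} (hc : c ≠ 0)
    (h : ∀ x, d * x * c + c * x * d = 0) : d = 0 := by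
  by_cases hli : LinearIndependent K ![c, d]
  · exact eq_zero_of_sum_mul_mul_eq_zero (a := ![d, c]) hli (fun x => by simpa using h x) 0
  · rw [LinearIndependent.pair_iff' hc] at hli
    push Not at hli
    obtain ⟨k, rfl⟩ := hli
    have hli : LinearIndependent K ![c] := LinearIndependent.of_subsingleton 0 hc
    refine eq_zero_of_sum_mul_mul_eq_zero (a := ![k • c]) hli (fun x => ?_) 0
    have := h x
    rw [mul_smul_comm, smul_mul_assoc, smul_mul_assoc, ← two_smul K] at this
    simpa using (smul_eq_zero.1 this).resolve_left h2

/-- A Jordan derivation of a central simple algebra that vanishes on the center is a derivation. -/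
theorem mul_of_jordanDerivation (h2 : (2 : K) ≠ 0)
    (hJ : ∀ x y, D (x * y + y * x) = D x * y + x * D y + (D y * x + y * D x))
    (hK : ∀ k : K, D (algebraMap K A k) = 0) (a b : A) : D (a * b) = D a * b + a * D b := by
  have h2' : IsUnit (2 : A) := by
    rw [← map_ofNat (algebraMap K A) 2]
    exact (IsUnit.mk0 (2 : K) h2).map (algebraMap K A)
  have hnc (a b : A) (hab : a * b - b * a ≠ 0) : D (a * b) = D a * b + a * D b := by
    have := eq_zero_of_mul_mul_add_eq_zero h2 hab (jordanDerivation_defect_mul h2' hJ a b)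
    rwa [sub_sub, sub_eq_zero] at this
  by_cases hab : a * b - b * a = 0
  · by_cases hcent : ∀ d, d * a = a * d
    · obtain ⟨k, rfl⟩ := exists_algebraMap_eq_of_commute (K := K) hcent
      have := hJ (algebraMap K A k) b
      rw [hK, ← Algebra.commutes k b, ← Algebra.commutes k (D b), zero_mul, mul_zero, add_zero,
        zero_add, map_add, ← two_mul, ← two_mul] at this
      rw [hK, zero_mul, zero_add]
      exact h2'.mul_left_cancel this
    · push Not at hcent
      obtain ⟨d, hd⟩ := hcent
      have hd' : a * d - d * a ≠ 0 := fun h => hd (sub_eq_zero.1 h).symm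
      have h1 := hnc a d hd'
      -- When `a` commutes with `b` but not with `d`, it does not commute with `b + d` either;
      -- subtracting the two product rules leaves the one for `a * b`.
      have h2 := hnc a (b + d) (by
        rwa [mul_add, add_mul, add_sub_add_comm, hab, zero_add])
      rw [mul_add, map_add, map_add, h1, mul_add, mul_add] at h2
      have : D (a * b) = (D (a * b) + (D a * d + a * D d)) - (D a * d + a * D d) := by abel
      rw [this, h2]
      abel
  · exact hnc a b hab

/-- Derivations of central simple algebras are inner. -/
theorem exists_eq_commutator_of_derivation
    (hD : ∀ a b, D (a * b) = D a * b + a * D b)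
    (hK : ∀ k : K, D (algebraMap K A k) = 0) : ∃ a, ∀ x, D x = a * x - x * a := by
  let D' : A →ₗ[K] A :=
    { D with
      map_smul' := fun k x => by simp [Algebra.smul_def, hD, hK] }
  obtain ⟨t, ht⟩ := mulLeftRight_surjective D'
  let b := Module.finBasis K A
  obtain ⟨s, hs⟩ := TensorProduct.eq_repr_basis_right (M := A) (b.map (MulOpposite.opLinearEquiv K)) t
  have hDs (x : A) : D x = ∑ j, s j * x * b j := by
    change D' x = _
    rw [← ht, ← hs, Finsupp.sum_fintype _ _ (by simp)]
    simp
  -- Both sides of `D (x * y) - x * D y = D x * y` are expanded along the `b j`, writing `1 = ∑ j,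
  -- b.repr 1 j • b j`, and coefficients are compared.
  have key (x : A) (j) : s j * x - x * s j - b.repr 1 j • D x = 0 := by
    refine eq_zero_of_sum_mul_mul_eq_zero (K := K) b.linearIndependent
      (a := fun j => s j * x - x * s j - b.repr 1 j • D x) (fun y => ?_) j
    have h1 : ∑ j, b.repr 1 j • b j = 1 := b.sum_repr 1
    have h2 : ∑ j, b.repr 1 j • D x * y * b j = D x * y := by
      conv_rhs => rw [← mul_one (D x * y), ← h1, Finset.mul_sum]
      simp
    have h3 := hD x y
    rw [hDs (x * y), hDs y, Finset.mul_sum] at h3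
    simp only [sub_mul, Finset.sum_sub_distrib, h2, sub_eq_zero]
    rw [sub_eq_iff_eq_add]
    simpa [mul_assoc] using h3
  obtain ⟨j, hj⟩ : ∃ j, b.repr 1 j ≠ 0 := by
    by_contra! hcon
    exact one_ne_zero (b.ext_elem (y := 0) fun j => by simpa using hcon j)
  refine ⟨(b.repr 1 j)⁻¹ • s j, fun x => ?_⟩
  rw [smul_mul_assoc, mul_smul_comm, ← smul_sub, sub_eq_zero.1 (key x j), smul_smul,
    inv_mul_cancel₀ hj, one_smul]

/-- A local inner derivation of a central simple algebra is a Jordan derivation. -/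
theorem jordanDerivation_of_local (K : Type*) {A : Type*} [Field K] [Ring A] [Algebra K A]
    [Algebra.IsCentral K A] [IsSimpleRing A] [FiniteDimensional K A] {D : A →+ A}
    (hD : ∀ x, ∃ a, D x = a * x - x * a) (x y : A) :
    D (x * y + y * x) = D x * y + x * D y + (D y * x + y * D x) := by
  obtain ⟨g, hg0, hg⟩ := exists_trace_ne_zero (K := K) (A := A)
  have hskew1 (x : A) : g (D x * x) = 0 := by
    obtain ⟨a, ha⟩ := hD x
    rw [ha, sub_mul, map_sub, mul_assoc, mul_assoc, hg x, mul_assoc, sub_self]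
  have hcub1 (x : A) : g (D x * (x * x)) = 0 := by
    obtain ⟨a, ha⟩ := hD x
    rw [ha, sub_mul, map_sub, mul_assoc, mul_assoc, hg x, mul_assoc, mul_assoc, sub_self]
  have hskew (x y : A) : g (D x * y) + g (D y * x) = 0 := by
    have := hskew1 (x + y)
    simpa [add_mul, mul_add, hskew1, add_comm] using this
  have hcub (x y z : A) : g (D x * (y * z + z * y)) + g (D y * (x * z + z * x))
      + g (D z * (x * y + y * x)) = 0 := by
    have h0 := hcub1 (x + y + z)
    have h1 := hcub1 (x + y)
    have h2 := hcub1 (x + z)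
    have h3 := hcub1 (y + z)
    simp only [map_add, add_mul, mul_add, hcub1, add_zero, zero_add] at h0 h1 h2 h3 ⊢
    -- Inclusion–exclusion isolates the trilinear part without dividing by any integer.
    linear_combination h0 - h1 - h2 - h3
  refine sub_eq_zero.1 (eq_zero_of_trace_mul_eq_zero hg0 hg fun z => ?_)
  have h1 := hskew (x * y + y * x) z
  have h2 := hcub x y z
  have e1 := hg x (D y * z)
  have e2 := hg y (D x * z)
  simp only [map_add, map_sub, add_mul, sub_mul, mul_add, mul_assoc] at h1 h2 e1 e2 ⊢
  linear_combination h1 - h2 - e1 - e2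

/-- Local inner derivations of central simple algebras are inner. -/
theorem exists_eq_commutator_of_local (h2 : (2 : K) ≠ 0) (hD : ∀ x, ∃ a, D x = a * x - x * a) :
    ∃ a, ∀ x, D x = a * x - x * a := by
  have hK (k : K) : D (algebraMap K A k) = 0 := by
    obtain ⟨a, ha⟩ := hD (algebraMap K A k)
    rw [ha, Algebra.commutes, sub_self]
  exact exists_eq_commutator_of_derivation
    (mul_of_jordanDerivation h2 (jordanDerivation_of_local K hD) hK) hK

end CentralSimple

/-! ### Reduction to simple factors -/

section Semisimple

/-- Every additive map that agrees at each point with a commutator map is a commutator map. -/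
def LocalInnerIsInner (R : Type*) [Ring R] : Prop :=
  ∀ D : R →+ R, (∀ x, ∃ a, D x = a * x - x * a) → ∃ a, ∀ x, D x = a * x - x * a

/-- The base field becomes the center `K`, over which `D` is not known to be linear; hence the
additive formulation. -/
theorem localInnerIsInner_of_isSimpleRing (F A : Type*) [Field F] [Ring A] [Algebra F A]
    [IsSimpleRing A] [Module.Finite F A] (h2 : (2 : F) ≠ 0) : LocalInnerIsInner A := by
  intro D hD
  obtain ⟨K, _, ⟨e⟩⟩ : ∃ (K : Type _) (_ : Field K), Nonempty (K ≃+* Subalgebra.center F A) :=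
    ⟨_, (show IsField (Subalgebra.center F A) from IsSimpleRing.isField_center A).toField,
      ⟨RingEquiv.refl _⟩⟩
  let _ : Algebra K A := ((Subalgebra.center F A).val.toRingHom.comp e.toRingHom).toAlgebra'
    fun k x => (Subalgebra.mem_center_iff.1 (e k).2 x).symm
  let _ : Algebra F K :=
    (e.symm.toRingHom.comp (algebraMap F (Subalgebra.center F A))).toAlgebra
  have hAK (k : K) : algebraMap K A k = (e k : A) := rfl
  have hKF (c : F) : algebraMap F K c = e.symm (algebraMap F _ c) := rfl
  have : IsScalarTower F K A := IsScalarTower.of_algebraMap_eq fun c => by simp [hAK, hKF]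
  have : Algebra.IsCentral K A :=
    ⟨fun z hz => Algebra.mem_bot.2
      ⟨e.symm ⟨z, Subalgebra.mem_center_iff.2 (Subalgebra.mem_center_iff.1 hz)⟩, by simp [hAK]⟩⟩
  have : FiniteDimensional K A := Module.Finite.of_restrictScalars_finite F _ _
  refine exists_eq_commutator_of_local (K := K) ?_ hD
  rw [← map_ofNat (algebraMap F K) 2]
  exact (map_ne_zero _).2 h2

/-- A commutator with an element of one factor stays in that factor, so `D` acts factor by factor.
-/
theorem LocalInnerIsInner.pi {ι : Type*} [Finite ι] {B : ι → Type*} [∀ i, Ring (B i)]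
    (h : ∀ i, LocalInnerIsInner (B i)) : LocalInnerIsInner (∀ i, B i) := by
  classical
  have := Fintype.ofFinite ι
  intro D hD
  have hcoord (i : ι) : ∃ a, ∀ y : B i, D (Pi.single i y) i = a * y - y * a := by
    refine h i ((Pi.evalAddMonoidHom B i).comp (D.comp (AddMonoidHom.single B i))) fun y => ?_
    obtain ⟨a, ha⟩ := hD (Pi.single i y)
    exact ⟨a i, by simp [ha]⟩
  choose a ha using hcoord
  refine ⟨a, fun x => ?_⟩
  ext j
  conv_lhs => rw [← Finset.univ_sum_single x, map_sum, Finset.sum_apply]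
  rw [Finset.sum_eq_single j _ (by simp), ha]
  · rfl
  · intro i _ hij
    obtain ⟨c, hc⟩ := hD (Pi.single i (x i))
    simp [hc, Pi.single_eq_of_ne' hij]

theorem LocalInnerIsInner.of_ringEquiv {R S : Type*} [Ring R] [Ring S] (e : R ≃+* S)
    (h : LocalInnerIsInner S) : LocalInnerIsInner R := by
  intro D hD
  obtain ⟨a, ha⟩ := h ((e : R →+ S).comp (D.comp (e.symm : S →+ R))) fun x => by
    obtain ⟨a, ha⟩ := hD (e.symm x)
    exact ⟨e a, by simp [ha]⟩
  refine ⟨e.symm a, fun x => e.injective ?_⟩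
  simpa using ha (e x)

theorem localInnerIsInner_of_isSemisimpleRing (F R : Type*) [Field F] [Ring R] [Algebra F R]
    [IsSemisimpleRing R] [Module.Finite F R] (h2 : (2 : F) ≠ 0) : LocalInnerIsInner R := by
  obtain ⟨n, Δ, d, _, _, _, _, ⟨e⟩⟩ :=
    IsSemisimpleRing.exists_algEquiv_pi_matrix_divisionRing_finite F R
  exact .of_ringEquiv e.toRingEquiv (.pi fun _ => localInnerIsInner_of_isSimpleRing F _ h2)

end Semisimple

/-! ### Semisimplicity of the unitization -/

section Unitization

variable {F A : Type*} [Field F] [NonUnitalRing A] [Module F A]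
    [IsScalarTower F A A] [SMulCommClass F A A] [FiniteDimensional F A]

instance finite_unitization : Module.Finite F (Unitization F A) :=
  Module.Finite.of_surjective
    ((LinearMap.toSpanSingleton F (Unitization F A) 1).coprod (Unitization.inrHom F F A))
    fun x => ⟨(x.fst, x.snd), by ext <;> simp⟩

/-- The unitization of a finite-dimensional semisimple algebra is a semisimple ring. -/
theorem isSemisimpleRing_unitization (hA : IsSemisimpleAlg F A) :
    IsSemisimpleRing (Unitization F A) := by
  have : IsArtinianRing (Unitization F A) := IsArtinianRing.of_finite F _
  rw [IsArtinianRing.isSemisimpleRing_iff_jacobson]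
  obtain ⟨n, hn⟩ := IsSemiprimaryRing.isNilpotent (R := Unitization F A)
  set J := Ring.jacobson (Unitization F A)
  let I : Submodule F A := (J.restrictScalars F).comap (Unitization.inrHom F F A)
  have hI (a : A) : a ∈ I ↔ (a : Unitization F A) ∈ J := Iff.rfl
  have hideal : IsAlgIdeal F I := fun a x hx => by
    rw [hI] at hx
    rw [hI, hI, Unitization.inr_mul, Unitization.inr_mul]
    exact ⟨J.mul_mem_left _ hx, J.mul_mem_right _ hx⟩
  have hpow (m : ℕ) (a : A) (ha : a ∈ idealPowSucc F I m) :
      (a : Unitization F A) ∈ J ^ (m + 1) := by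
    induction m generalizing a with
    | zero => rwa [zero_add, Submodule.pow_one]
    | succ m ih =>
      rw [Submodule.pow_succ]
      induction ha using Submodule.span_induction with
      | mem z hz =>
        obtain ⟨x, hx, y, hy, rfl⟩ := hz
        rw [Unitization.inr_mul]
        exact Ideal.mul_mem_mul (ih x hx) hy
      | zero => simp
      | add u v _ _ hu hv => rw [Unitization.inr_add]; exact add_mem hu hv
      | smul k u _ hu =>
        rw [Unitization.inr_smul, Algebra.smul_def]
        exact Ideal.mul_mem_left _ _ hu
  have hnil : IsNilpotentIdeal F I := by
    refine ⟨n, (Submodule.eq_bot_iff _).2 fun a ha => ?_⟩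
    have := hpow n a ha
    rw [Submodule.pow_succ, hn, Submodule.zero_eq_bot, Submodule.bot_mul,
      Submodule.mem_bot] at this
    exact Unitization.inr_injective (R := F) (by rw [this, Unitization.inr_zero])
  have hbot : I = ⊥ := le_bot_iff.1 (hA ▸ le_sSup ⟨hideal, hnil⟩)
  refine (Submodule.eq_bot_iff _).2 fun x hx => ?_
  have hxn : x ^ n = 0 := by simpa [hn] using Ideal.pow_mem_pow hx n
  -- The scalar part of a nilpotent element is nilpotent in `F`, so the Jacobson radical lies inside
  -- `A`.
  have hfst : x.fst = 0 := by
    have := congrArg (Unitization.fstHom F A) hxn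
    rw [map_pow, map_zero] at this
    exact eq_zero_of_pow_eq_zero this
  have hx' : x = (x.snd : Unitization F A) := by ext <;> simp [hfst]
  have hsnd : x.snd ∈ I := by rwa [hI, ← hx']
  rw [hbot, Submodule.mem_bot] at hsnd
  rw [hx', hsnd, Unitization.inr_zero]

end Unitization

end FDAlg

theorem corollary2p6 {F A : Type*} [Field F] [NonUnitalRing A] [Module F A]
    [IsScalarTower F A A] [SMulCommClass F A A] [FiniteDimensional F A]
    (hF : ringChar F ≠ 2) (hA : FDAlg.IsSemisimpleAlg F A)
    (D : A →ₗ[F] A) (hD : FDAlg.IsLocalInnerDerivation D) :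
    FDAlg.IsInnerDerivation D := by
  have := FDAlg.isSemisimpleRing_unitization hA
  let D' : Unitization F A →+ Unitization F A :=
    (Unitization.inrHom F F A ∘ₗ D ∘ₗ Unitization.sndHom F F A).toAddMonoidHom
  have hD' (x) : D' x = (D x.snd : A) := rfl
  obtain ⟨a, ha⟩ := FDAlg.localInnerIsInner_of_isSemisimpleRing F (Unitization F A)
    (Ring.two_ne_zero hF) D' fun x => by
      obtain ⟨_, ⟨a, ha⟩, hx⟩ := hD x.snd
      refine ⟨a, ?_⟩
      rw [hD', hx, ha, Unitization.inr_sub, sub_eq_sub_iff_add_eq_add]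
      ext
      · simp
      · simp [add_comm, add_left_comm]
  -- The scalar part of `a` is central and does not affect the commutator.
  refine ⟨a.snd, fun x => ?_⟩
  have := congrArg (Unitization.sndHom F F A) (eq_sub_iff_add_eq.1 (ha x))
  rw [eq_sub_iff_add_eq]
  refine add_right_cancel (b := a.fst • x) ?_
  simpa [hD', add_comm, add_left_comm, add_assoc] using this
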